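/- Let $\mathcal L=(L,\vee,\bot)$ be a bounded join-semilattice with order $\sqsubseteq$. The calculus $\mathrm{DCC}_e(\mathcal L)$ is the simply-typed $\lambda$-calculus with types $A,B ::= \mathrm{Unit}\mid\mathrm{Void}\mid A\to B\mid A\times B\mid A+B\mid T_\ell\,A$ $(\ell\in L)$ and terms $a,b ::= x\mid\lambda x{:}A.\,b\mid b\,a\mid(a_1,a_2)\mid\mathbf{proj}_i\,a\mid\mathrm{unit}\mid\mathbf{inj}_i\,a\mid\mathbf{case}\ a\ \mathbf{of}\ b_1;b_2\mid\mathbf{abort}\ a\mid\mathbf{eta}^\ell a\mid\mathbf{bind}^\ell x=a\ \mathbf{in}\ b$; put $\mathrm{Bool}:=\mathrm{Unit}+\mathrm{Unit}$. The protection judgement $\ell\sqsubseteq A$ (for $\ell\in L$ and a type $A$) is inductively generated by the rules: - if $\ell\sqsubseteq A$ and $\ell\sqsubseteq B$, then $\ell\sqsubseteq A\times B$; - if $\ell\sqsubseteq B$, then $\ell\sqsubseteq A\to B$; - if $\ell\sqsubseteq\ell'$, then $\ell\sqsubseteq T_{\ell'}A$; - if $\ell\sqsubseteq A$, then $\ell\sqsubseteq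 T_{\ell'}A$; - $\bot\sqsubseteq A$; - if $\ell_1\sqsubseteq A$, $\ell_2\sqsubseteq A$ and $\ell\sqsubseteq\ell_1\vee\ell_2$, then $\ell\sqsubseteq A$. The typing judgement $\Gamma\vdash a:A$ is given by the usual rules of the simply-typed $\lambda$-calculus (with $\mathbf{case}\ a\ \mathbf{of}\ b_1;b_2 : B$ when $a:A_1+A_2$ and $b_i:A_i\to B$) together with: if $\Gamma\vdash a:A$, then $\Gamma\vdash\mathbf{eta}^\ell a:T_\ell A$; and if $\Gamma\vdash a:T_\ell A$, $\Gamma,x{:}A\vdash b:B$ and $\ell\sqsubseteq B$, then $\Gamma\vdash\mathbf{bind}^\ell x=a\ \mathbf{in}\ b:B$. Values are $v ::= \lambda x{:}A.\,b\mid(v_1,v_2)\mid\mathrm{unit}\mid\mathbf{inj}_i\,v\mid\mathbf{eta}^\ell v$. The relation $\leadsto^*$ is the reflexive-transitive closure of one-step (left-to-right) call-by-value reduction $\leadsto$, which has the $\beta$-rules $(\lambda x{:}A.\,b)\,v\leadsto b\{v/x\}$, $\mathbf{proj}_i(v_1,v_2)\leadsto v_i$, $\mathbf{case}\ (\mathbf{inj}_i\,v)\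 \mathbf{of}\ b_1;b_2\leadsto b_i\,v$ and $\mathbf{bind}^\ell x=\mathbf{eta}^\ell v\ \mathbf{in}\ b\leadsto b\{v/x\}$, and which evaluates the function and then the argument of an application, the components of a pair from left to right, and the arguments of $\mathbf{proj}_i$, $\mathbf{inj}_i$, $\mathbf{abort}$, $\mathbf{eta}^\ell$, the scrutinee of $\mathbf{case}$ and the first argument $a$ of $\mathbf{bind}$; nothing is reduced under $\lambda$, in the branches of $\mathbf{case}$ or in the body of $\mathbf{bind}$. **Theorem (noninterference for $\mathrm{DCC}_e$).** 1. Let $\ell\in L$ with $\neg(\ell\sqsubseteq\bot)$, and let $\ell\sqsubseteq A$. Let $\emptyset\vdash f:A\to\mathrm{Bool}$, $\emptyset\vdash a_1:A$ and $\emptyset\vdash a_2:A$. Then for every value $v$ of type $\mathrm{Bool}$ (that is, $\emptyset\vdash v:\mathrm{Bool}$), $f\,a_1\leadsto^* v$ if and only if $f\,a_2\leadsto^* v$. 2. Let $\ell,\ell'\in L$ with $\neg(\ell\sqsubseteq\ell')$, and let $\ell\sqsubseteq A$. Let $\emptyset\vdash f:A\to T_{\ell'}\mathrm{Bool}$, $\emptyset\vdash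 a_1:A$ and $\emptyset\vdash a_2:A$. Then for every value $v$ of type $T_{\ell'}\mathrm{Bool}$, $f\,a_1\leadsto^* v$ if and only if $f\,a_2\leadsto^* v$. -/

import Mathlib

universe u

namespace DCCe

/-- Types over a set `L` of levels. `mon l A` is the graded modal type `T_l A`. -/
inductive Ty (L : Type u) : Type u where
  | unit : Ty L
  | void : Ty L
  | fn (A B : Ty L) : Ty L
  | prod (A B : Ty L) : Ty L
  | sum (A B : Ty L) : Ty L
  | mon (l : L) (A : Ty L) : Ty L

/-- `Bool := Unit + Unit`. -/
abbrev Ty.bool {L : Type u} : Ty L := Ty.sum Ty.unit Ty.unit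

/-- Terms, up to renaming of bound variables: variables are de Bruijn indices. The only binders are
`lam A b` (the term `λ x : A. b`) and `bind l a b` (the term `bind^l x = a in b`); each binds index
`0` in `b`. In `caseOf a b₁ b₂` the branches are terms of function type. -/
inductive Tm (L : Type u) : Type u where
  | var (n : ℕ) : Tm L
  | lam (A : Ty L) (b : Tm L) : Tm L
  | app (b a : Tm L) : Tm L
  | pair (a₁ a₂ : Tm L) : Tm L
  | proj₁ (a : Tm L) : Tm L
  | proj₂ (a : Tm L) : Tm L
  | unit : Tm L
  | inj₁ (a : Tm L) : Tm L
  | inj₂ (a : Tm L) : Tm L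
  | caseOf (a b₁ b₂ : Tm L) : Tm L
  | abort (a : Tm L) : Tm L
  | eta (l : L) (a : Tm L) : Tm L
  | bind (l : L) (a b : Tm L) : Tm L

/-- Lift a renaming of variables under one binder. -/
def upRen (r : ℕ → ℕ) : ℕ → ℕ
  | 0 => 0
  | n + 1 => r n + 1

namespace Tm

variable {L : Type u}

/-- Simultaneous renaming of variables. -/
def rename : (ℕ → ℕ) → Tm L → Tm L
  | r, var n => var (r n)
  | r, lam A b => lam A (rename (upRen r) b)
  | r, app b a => app (rename r b) (rename r a)
  | r, pair a₁ a₂ => pair (rename r a₁) (rename r a₂)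
  | r, proj₁ a => proj₁ (rename r a)
  | r, proj₂ a => proj₂ (rename r a)
  | _, unit => unit
  | r, inj₁ a => inj₁ (rename r a)
  | r, inj₂ a => inj₂ (rename r a)
  | r, caseOf a b₁ b₂ => caseOf (rename r a) (rename r b₁) (rename r b₂)
  | r, abort a => abort (rename r a)
  | r, eta l a => eta l (rename r a)
  | r, bind l a b => bind l (rename r a) (rename (upRen r) b)

/-- Lift a substitution under one binder. -/
def upSub (s : ℕ → Tm L) : ℕ → Tm L
  | 0 => var 0
  | n + 1 => rename Nat.succ (s n)

/-- Simultaneous capture-avoiding substitution. -/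
def subst : (ℕ → Tm L) → Tm L → Tm L
  | s, var n => s n
  | s, lam A b => lam A (subst (upSub s) b)
  | s, app b a => app (subst s b) (subst s a)
  | s, pair a₁ a₂ => pair (subst s a₁) (subst s a₂)
  | s, proj₁ a => proj₁ (subst s a)
  | s, proj₂ a => proj₂ (subst s a)
  | _, unit => unit
  | s, inj₁ a => inj₁ (subst s a)
  | s, inj₂ a => inj₂ (subst s a)
  | s, caseOf a b₁ b₂ => caseOf (subst s a) (subst s b₁) (subst s b₂)
  | s, abort a => abort (subst s a)
  | s, eta l a => eta l (subst s a)
  | s, bind l a b => bind l (subst s a) (subst (upSub s) b)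

/-- The substitution `0 ↦ v`, `n + 1 ↦ n`. -/
def single (v : Tm L) : ℕ → Tm L
  | 0 => v
  | n + 1 => var n

/-- `inst b v` is `b {v / x}`, where `x` is the variable with index `0` in `b`. -/
def inst (b v : Tm L) : Tm L := subst (single v) b

end Tm

/-- The protection judgement `l ⊑ A`, with the two extended rules `minimum` and `combine`. -/
inductive Protect {L : Type u} [SemilatticeSup L] [OrderBot L] : L → Ty L → Prop where
  | prod {l : L} {A B : Ty L} : Protect l A → Protect l B → Protect l (Ty.prod A B)
  | fn {l : L} {A B : Ty L} : Protect l B → Protect l (Ty.fn A B)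
  | monad {l l' : L} {A : Ty L} : l ≤ l' → Protect l (Ty.mon l' A)
  | already {l l' : L} {A : Ty L} : Protect l A → Protect l (Ty.mon l' A)
  | minimum {A : Ty L} : Protect ⊥ A
  | combine {l l₁ l₂ : L} {A : Ty L} :
      Protect l₁ A → Protect l₂ A → l ≤ l₁ ⊔ l₂ → Protect l A

/-- The typing judgement `Γ ⊢ a : A`. A context lists the types of the variables; its head is the
type of the variable with index `0`. -/
inductive HasType {L : Type u} [SemilatticeSup L] [OrderBot L] :
    List (Ty L) → Tm L → Ty L → Prop where
  | var {Γ : List (Ty L)} {n : ℕ} {A : Ty L} : Γ[n]? = some A → HasType Γ (Tm.var n) A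
  | lam {Γ : List (Ty L)} {A B : Ty L} {b : Tm L} :
      HasType (A :: Γ) b B → HasType Γ (Tm.lam A b) (Ty.fn A B)
  | app {Γ : List (Ty L)} {A B : Ty L} {b a : Tm L} :
      HasType Γ b (Ty.fn A B) → HasType Γ a A → HasType Γ (Tm.app b a) B
  | pair {Γ : List (Ty L)} {A₁ A₂ : Ty L} {a₁ a₂ : Tm L} :
      HasType Γ a₁ A₁ → HasType Γ a₂ A₂ → HasType Γ (Tm.pair a₁ a₂) (Ty.prod A₁ A₂)
  | proj₁ {Γ : List (Ty L)} {A₁ A₂ : Ty L} {a : Tm L} :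
      HasType Γ a (Ty.prod A₁ A₂) → HasType Γ (Tm.proj₁ a) A₁
  | proj₂ {Γ : List (Ty L)} {A₁ A₂ : Ty L} {a : Tm L} :
      HasType Γ a (Ty.prod A₁ A₂) → HasType Γ (Tm.proj₂ a) A₂
  | unit {Γ : List (Ty L)} : HasType Γ Tm.unit Ty.unit
  | inj₁ {Γ : List (Ty L)} {A₁ A₂ : Ty L} {a : Tm L} :
      HasType Γ a A₁ → HasType Γ (Tm.inj₁ a) (Ty.sum A₁ A₂)
  | inj₂ {Γ : List (Ty L)} {A₁ A₂ : Ty L} {a : Tm L} :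
      HasType Γ a A₂ → HasType Γ (Tm.inj₂ a) (Ty.sum A₁ A₂)
  | caseOf {Γ : List (Ty L)} {A₁ A₂ B : Ty L} {a b₁ b₂ : Tm L} :
      HasType Γ a (Ty.sum A₁ A₂) → HasType Γ b₁ (Ty.fn A₁ B) → HasType Γ b₂ (Ty.fn A₂ B) →
      HasType Γ (Tm.caseOf a b₁ b₂) B
  | abort {Γ : List (Ty L)} {A : Ty L} {a : Tm L} :
      HasType Γ a Ty.void → HasType Γ (Tm.abort a) A
  | eta {Γ : List (Ty L)} {l : L} {A : Ty L} {a : Tm L} :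
      HasType Γ a A → HasType Γ (Tm.eta l a) (Ty.mon l A)
  | bind {Γ : List (Ty L)} {l : L} {A B : Ty L} {a b : Tm L} :
      HasType Γ a (Ty.mon l A) → HasType (A :: Γ) b B → Protect l B →
      HasType Γ (Tm.bind l a b) B

/-- Call-by-value values; evaluation takes place under `eta`. -/
inductive Value {L : Type u} : Tm L → Prop where
  | lam {A : Ty L} {b : Tm L} : Value (Tm.lam A b)
  | pair {v₁ v₂ : Tm L} : Value v₁ → Value v₂ → Value (Tm.pair v₁ v₂)
  | unit : Value Tm.unit
  | inj₁ {v : Tm L} : Value v → Value (Tm.inj₁ v)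
  | inj₂ {v : Tm L} : Value v → Value (Tm.inj₂ v)
  | eta {l : L} {v : Tm L} : Value v → Value (Tm.eta l v)

/-- One step `⊢ a ⇝ a'` of (left-to-right) call-by-value reduction. -/
inductive Step {L : Type u} : Tm L → Tm L → Prop where
  | appLeft {b b' a : Tm L} : Step b b' → Step (Tm.app b a) (Tm.app b' a)
  | appRight {v a a' : Tm L} : Value v → Step a a' → Step (Tm.app v a) (Tm.app v a')
  | appBeta {A : Ty L} {b v : Tm L} : Value v → Step (Tm.app (Tm.lam A b) v) (Tm.inst b v)
  | pairLeft {a₁ a₁' a₂ : Tm L} : Step a₁ a₁' → Step (Tm.pair a₁ a₂) (Tm.pair a₁' a₂)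
  | pairRight {v a₂ a₂' : Tm L} :
      Value v → Step a₂ a₂' → Step (Tm.pair v a₂) (Tm.pair v a₂')
  | proj₁ {a a' : Tm L} : Step a a' → Step (Tm.proj₁ a) (Tm.proj₁ a')
  | proj₂ {a a' : Tm L} : Step a a' → Step (Tm.proj₂ a) (Tm.proj₂ a')
  | proj₁Beta {v₁ v₂ : Tm L} : Value v₁ → Value v₂ → Step (Tm.proj₁ (Tm.pair v₁ v₂)) v₁
  | proj₂Beta {v₁ v₂ : Tm L} : Value v₁ → Value v₂ → Step (Tm.proj₂ (Tm.pair v₁ v₂)) v₂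
  | inj₁ {a a' : Tm L} : Step a a' → Step (Tm.inj₁ a) (Tm.inj₁ a')
  | inj₂ {a a' : Tm L} : Step a a' → Step (Tm.inj₂ a) (Tm.inj₂ a')
  | caseOf {a a' b₁ b₂ : Tm L} : Step a a' → Step (Tm.caseOf a b₁ b₂) (Tm.caseOf a' b₁ b₂)
  | caseBeta₁ {v b₁ b₂ : Tm L} :
      Value v → Step (Tm.caseOf (Tm.inj₁ v) b₁ b₂) (Tm.app b₁ v)
  | caseBeta₂ {v b₁ b₂ : Tm L} :
      Value v → Step (Tm.caseOf (Tm.inj₂ v) b₁ b₂) (Tm.app b₂ v)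
  | abort {a a' : Tm L} : Step a a' → Step (Tm.abort a) (Tm.abort a')
  | eta {l : L} {a a' : Tm L} : Step a a' → Step (Tm.eta l a) (Tm.eta l a')
  | bindLeft {l : L} {a a' b : Tm L} : Step a a' → Step (Tm.bind l a b) (Tm.bind l a' b)
  | bindBeta {l : L} {v b : Tm L} :
      Value v → Step (Tm.bind l (Tm.eta l v) b) (Tm.inst b v)

/-- Multistep reduction `⊢ a ⇝* a'`. -/
abbrev Steps {L : Type u} : Tm L → Tm L → Prop := Relation.ReflTransGen Step

end DCCe

/-! The proof uses two logical relations over big-step evaluation `Eval`, which reaches the same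
values as `Steps`. The binary relation `Rel k` says what an observer at level `k` can distinguish:
contents of `T_l A` are compared only when `l ≤ k`. It is a partial-correctness relation,
constraining only results that exist. Hence if `l ⊑ A` and `¬ l ≤ k`, any two terms are related at
`A` (`Protect.rel`), with no condition of typing or termination. Well-typed terms send related
inputs to related results (`HasType.rel_subst`), so `f a₁` and `f a₂` have related results whenever
both have one. The observer is `⊥` in part 1 and `l'` in part 2; at either level related Booleans
are equal. The unary relation `Norm` supplies the missing existence: every closed well-typed term
has a value, so one run reaching `v` forces the other to reach it too. -/

namespace DCCe

namespace Tm

variable {L : Type u}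

/-! ### Substitution calculus -/

theorem upRen_comp (r r' : ℕ → ℕ) : upRen r' ∘ upRen r = upRen (r' ∘ r) := by
  funext n; cases n <;> rfl

theorem rename_rename (a : Tm L) (r r' : ℕ → ℕ) :
    rename r' (rename r a) = rename (r' ∘ r) a := by
  induction a generalizing r r' <;> simp_all [rename, upRen_comp]

theorem upSub_comp_upRen (r : ℕ → ℕ) (s : ℕ → Tm L) :
    upSub s ∘ upRen r = upSub (s ∘ r) := by
  funext n; cases n <;> rfl

theorem subst_rename (a : Tm L) (r : ℕ → ℕ) (s : ℕ → Tm L) :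
    subst s (rename r a) = subst (s ∘ r) a := by
  induction a generalizing r s <;> simp_all [rename, subst, upSub_comp_upRen]

theorem rename_comp_upSub (r : ℕ → ℕ) (s : ℕ → Tm L) :
    rename (upRen r) ∘ upSub s = upSub (rename r ∘ s) := by
  funext n
  cases n with
  | zero => rfl
  | succ n => simp only [Function.comp_apply, upSub, rename_rename]; rfl

theorem rename_subst (a : Tm L) (r : ℕ → ℕ) (s : ℕ → Tm L) :
    rename r (subst s a) = subst (rename r ∘ s) a := by
  induction a generalizing r s <;> simp_all [rename, subst, rename_comp_upSub]

theorem subst_comp_upSub (s s' : ℕ → Tm L) :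
    subst (upSub s') ∘ upSub s = upSub (subst s' ∘ s) := by
  funext n
  cases n with
  | zero => rfl
  | succ n => simp only [Function.comp_apply, upSub, subst_rename, rename_subst]; rfl

theorem subst_subst (a : Tm L) (s s' : ℕ → Tm L) :
    subst s' (subst s a) = subst (subst s' ∘ s) a := by
  induction a generalizing s s' <;> simp_all [subst, subst_comp_upSub]

theorem upSub_var : upSub (var : ℕ → Tm L) = var := by
  funext n; cases n <;> rfl

theorem subst_var (a : Tm L) : subst var a = a := by
  induction a <;> simp_all [subst, upSub_var]

/-- The substitution `0 ↦ v`, `n + 1 ↦ s n`. -/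
def cons (v : Tm L) (s : ℕ → Tm L) : ℕ → Tm L
  | 0 => v
  | n + 1 => s n

/-- Turns a β-step under an environment into an extension of that environment, as the binder cases
of both fundamental lemmas require. -/
theorem inst_subst_upSub (b v : Tm L) (s : ℕ → Tm L) :
    inst (subst (upSub s) b) v = subst (cons v s) b := by
  rw [inst, subst_subst]
  congr 1
  funext n
  cases n with
  | zero => rfl
  | succ n =>
    simp only [Function.comp_apply, upSub, subst_rename]
    exact subst_var _

end Tm

/-! ### Big-step evaluation -/

section Eval

variable {L : Type u}

/-- Big-step call-by-value evaluation. -/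
inductive Eval : Tm L → Tm L → Prop where
  | lam {A : Ty L} {b : Tm L} : Eval (Tm.lam A b) (Tm.lam A b)
  | app {A : Ty L} {f a b w u : Tm L} :
      Eval f (Tm.lam A b) → Eval a w → Eval (Tm.inst b w) u → Eval (Tm.app f a) u
  | pair {a₁ a₂ v₁ v₂ : Tm L} :
      Eval a₁ v₁ → Eval a₂ v₂ → Eval (Tm.pair a₁ a₂) (Tm.pair v₁ v₂)
  | proj₁ {a v₁ v₂ : Tm L} : Eval a (Tm.pair v₁ v₂) → Eval (Tm.proj₁ a) v₁
  | proj₂ {a v₁ v₂ : Tm L} : Eval a (Tm.pair v₁ v₂) → Eval (Tm.proj₂ a) v₂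
  | unit : Eval Tm.unit Tm.unit
  | inj₁ {a v : Tm L} : Eval a v → Eval (Tm.inj₁ a) (Tm.inj₁ v)
  | inj₂ {a v : Tm L} : Eval a v → Eval (Tm.inj₂ a) (Tm.inj₂ v)
  | case₁ {a b₁ b₂ v u : Tm L} :
      Eval a (Tm.inj₁ v) → Eval (Tm.app b₁ v) u → Eval (Tm.caseOf a b₁ b₂) u
  | case₂ {a b₁ b₂ v u : Tm L} :
      Eval a (Tm.inj₂ v) → Eval (Tm.app b₂ v) u → Eval (Tm.caseOf a b₁ b₂) u
  | eta {l : L} {a v : Tm L} : Eval a v → Eval (Tm.eta l a) (Tm.eta l v)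
  | bind {l : L} {a b v u : Tm L} :
      Eval a (Tm.eta l v) → Eval (Tm.inst b v) u → Eval (Tm.bind l a b) u

theorem Eval.value {a v : Tm L} (h : Eval a v) : Value v := by
  induction h with
  | lam => exact .lam
  | app _ _ _ _ _ ih => exact ih
  | pair _ _ ih₁ ih₂ => exact .pair ih₁ ih₂
  | proj₁ _ ih => cases ih; assumption
  | proj₂ _ ih => cases ih; assumption
  | unit => exact .unit
  | inj₁ _ ih => exact .inj₁ ih
  | inj₂ _ ih => exact .inj₂ ih
  | case₁ _ _ _ ih => exact ih
  | case₂ _ _ _ ih => exact ih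
  | eta _ ih => exact .eta ih
  | bind _ _ _ ih => exact ih

theorem Value.eval {v : Tm L} (h : Value v) : Eval v v := by
  induction h with
  | lam => exact .lam
  | pair _ _ ih₁ ih₂ => exact .pair ih₁ ih₂
  | unit => exact .unit
  | inj₁ _ ih => exact .inj₁ ih
  | inj₂ _ ih => exact .inj₂ ih
  | eta _ ih => exact .eta ih

theorem Value.eq_of_eval {v u : Tm L} (h : Value v) (he : Eval v u) : u = v := by
  induction h generalizing u with
  | lam => cases he; rfl
  | pair _ _ ih₁ ih₂ => cases he with | pair h₁ h₂ => rw [ih₁ h₁, ih₂ h₂]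
  | unit => cases he; rfl
  | inj₁ _ ih => cases he with | inj₁ h => rw [ih h]
  | inj₂ _ ih => cases he with | inj₂ h => rw [ih h]
  | eta _ ih => cases he with | eta h => rw [ih h]

/-- Backward closure lets a reduction sequence be absorbed from its end, so confluence of `Step` is
never needed. -/
theorem Step.eval {a a' v : Tm L} (h : Step a a') (he : Eval a' v) : Eval a v := by
  induction h generalizing v with
  | appLeft _ ih => cases he with | app h₁ h₂ h₃ => exact .app (ih h₁) h₂ h₃
  | appRight _ _ ih => cases he with | app h₁ h₂ h₃ => exact .app h₁ (ih h₂) h₃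
  | appBeta hv => exact .app .lam hv.eval he
  | pairLeft _ ih => cases he with | pair h₁ h₂ => exact .pair (ih h₁) h₂
  | pairRight _ _ ih => cases he with | pair h₁ h₂ => exact .pair h₁ (ih h₂)
  | proj₁ _ ih => cases he with | proj₁ h => exact .proj₁ (ih h)
  | proj₂ _ ih => cases he with | proj₂ h => exact .proj₂ (ih h)
  | proj₁Beta h₁ h₂ => exact .proj₁ (.pair he h₂.eval)
  | proj₂Beta h₁ h₂ => exact .proj₂ (.pair h₁.eval he)
  | inj₁ _ ih => cases he with | inj₁ h => exact .inj₁ (ih h)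
  | inj₂ _ ih => cases he with | inj₂ h => exact .inj₂ (ih h)
  | caseOf _ ih =>
    cases he with
    | case₁ h₁ h₂ => exact .case₁ (ih h₁) h₂
    | case₂ h₁ h₂ => exact .case₂ (ih h₁) h₂
  | caseBeta₁ hv => exact .case₁ (.inj₁ hv.eval) he
  | caseBeta₂ hv => exact .case₂ (.inj₂ hv.eval) he
  -- `Eval` has no rule for `abort`, since `Void` has no values.
  | abort _ _ => cases he
  | eta _ ih => cases he with | eta h => exact .eta (ih h)
  | bindLeft _ ih => cases he with | bind h₁ h₂ => exact .bind (ih h₁) h₂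
  | bindBeta hv => exact .bind (.eta hv.eval) he

theorem Eval.steps {a v : Tm L} (h : Eval a v) : Steps a v := by
  induction h with
  | lam => exact .refl
  | @app A f a b w u hf ha _ ih₁ ih₂ ih₃ =>
    exact ((ih₁.lift (Tm.app · a) fun _ _ => .appLeft).trans
      (ih₂.lift (Tm.app (Tm.lam A b)) fun _ _ => .appRight .lam)).trans
      (.head (.appBeta ha.value) ih₃)
  | @pair a₁ a₂ v₁ v₂ h₁ _ ih₁ ih₂ =>
    exact (ih₁.lift (Tm.pair · a₂) fun _ _ => .pairLeft).trans
      (ih₂.lift (Tm.pair v₁) fun _ _ => .pairRight h₁.value)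
  | proj₁ h ih =>
    cases h.value with
    | pair h₁ h₂ => exact (ih.lift Tm.proj₁ fun _ _ => .proj₁).tail (.proj₁Beta h₁ h₂)
  | proj₂ h ih =>
    cases h.value with
    | pair h₁ h₂ => exact (ih.lift Tm.proj₂ fun _ _ => .proj₂).tail (.proj₂Beta h₁ h₂)
  | unit => exact .refl
  | inj₁ _ ih => exact ih.lift Tm.inj₁ fun _ _ => .inj₁
  | inj₂ _ ih => exact ih.lift Tm.inj₂ fun _ _ => .inj₂
  | @case₁ a b₁ b₂ v u h _ ih₁ ih₂ =>
    cases h.value with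
    | inj₁ hv =>
      exact (ih₁.lift (Tm.caseOf · b₁ b₂) fun _ _ => .caseOf).trans (.head (.caseBeta₁ hv) ih₂)
  | @case₂ a b₁ b₂ v u h _ ih₁ ih₂ =>
    cases h.value with
    | inj₂ hv =>
      exact (ih₁.lift (Tm.caseOf · b₁ b₂) fun _ _ => .caseOf).trans (.head (.caseBeta₂ hv) ih₂)
  | eta _ ih => exact ih.lift (Tm.eta _) fun _ _ => .eta
  | @bind l a b v u h _ ih₁ ih₂ =>
    cases h.value with
    | eta hv =>
      exact (ih₁.lift (Tm.bind l · b) fun _ _ => .bindLeft).trans (.head (.bindBeta hv) ih₂)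

theorem steps_iff_eval {a v : Tm L} (hv : Value v) : Steps a v ↔ Eval a v := by
  refine ⟨fun h => ?_, Eval.steps⟩
  induction h using Relation.ReflTransGen.head_induction_on with
  | refl => exact hv.eval
  | head h _ ih => exact h.eval ih

end Eval

/-! ### Termination -/

section Normalization

variable {L : Type u}

/-- Hereditarily terminating values of a type. -/
def Norm : Ty L → Tm L → Prop
  | .unit, v => v = Tm.unit
  | .void, _ => False
  | .fn A B, v => ∃ T b, v = Tm.lam T b ∧
      ∀ w, Value w → Norm A w → ∃ u, Eval (Tm.inst b w) u ∧ Norm B u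
  | .prod A B, v => ∃ a b, v = Tm.pair a b ∧ Norm A a ∧ Norm B b
  | .sum A B, v => (∃ a, v = Tm.inj₁ a ∧ Norm A a) ∨ (∃ b, v = Tm.inj₂ b ∧ Norm B b)
  | .mon l A, v => ∃ a, v = Tm.eta l a ∧ Norm A a

variable [SemilatticeSup L] [OrderBot L]

/-- Fundamental lemma for `Norm`. Quantifying over substitutions by normalizing values makes the
induction pass under `lam` and `bind`. -/
theorem HasType.exists_eval_subst {Γ : List (Ty L)} {a : Tm L} {A : Ty L} (h : HasType Γ a A)
    (s : ℕ → Tm L) (hs : ∀ n B, Γ[n]? = some B → Value (s n) ∧ Norm B (s n)) :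
    ∃ v, Eval (Tm.subst s a) v ∧ Norm A v := by
  have extend : ∀ {Γ : List (Ty L)} {s : ℕ → Tm L} {C : Ty L} {w : Tm L},
      (∀ n B, Γ[n]? = some B → Value (s n) ∧ Norm B (s n)) → Value w → Norm C w →
      ∀ n B, (C :: Γ)[n]? = some B → Value (Tm.cons w s n) ∧ Norm B (Tm.cons w s n) := by
    intro Γ s C w hs hw hC n B hn
    cases n with
    | zero => cases hn; exact ⟨hw, hC⟩
    | succ n => exact hs n B hn
  induction h generalizing s with
  | var h => exact ⟨_, (hs _ _ h).1.eval, (hs _ _ h).2⟩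
  | lam _ ih =>
    refine ⟨_, .lam, _, _, rfl, fun w hw hA => ?_⟩
    rw [Tm.inst_subst_upSub]
    exact ih _ (extend hs hw hA)
  | app _ _ ih₁ ih₂ =>
    obtain ⟨_, h₁, T, b, rfl, hb⟩ := ih₁ s hs
    obtain ⟨w, h₂, hw⟩ := ih₂ s hs
    obtain ⟨u, h₃, hu⟩ := hb w h₂.value hw
    exact ⟨u, .app h₁ h₂ h₃, hu⟩
  | pair _ _ ih₁ ih₂ =>
    obtain ⟨v, h₁, hv⟩ := ih₁ s hs
    obtain ⟨w, h₂, hw⟩ := ih₂ s hs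
    exact ⟨_, .pair h₁ h₂, _, _, rfl, hv, hw⟩
  | proj₁ _ ih =>
    obtain ⟨_, h, v, w, rfl, hv, hw⟩ := ih s hs
    exact ⟨v, .proj₁ h, hv⟩
  | proj₂ _ ih =>
    obtain ⟨_, h, v, w, rfl, hv, hw⟩ := ih s hs
    exact ⟨w, .proj₂ h, hw⟩
  | unit => exact ⟨_, .unit, rfl⟩
  | inj₁ _ ih =>
    obtain ⟨v, h, hv⟩ := ih s hs
    exact ⟨_, .inj₁ h, .inl ⟨v, rfl, hv⟩⟩
  | inj₂ _ ih =>
    obtain ⟨v, h, hv⟩ := ih s hs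
    exact ⟨_, .inj₂ h, .inr ⟨v, rfl, hv⟩⟩
  | caseOf _ _ _ ih ih₁ ih₂ =>
    obtain ⟨_, h, ⟨v, rfl, hv⟩ | ⟨v, rfl, hv⟩⟩ := ih s hs
    · obtain ⟨_, h₁, T, b, rfl, hb⟩ := ih₁ s hs
      cases h.value with
      | inj₁ hval =>
        obtain ⟨u, h₃, hu⟩ := hb v hval hv
        exact ⟨u, .case₁ h (.app h₁ hval.eval h₃), hu⟩
    · obtain ⟨_, h₂, T, b, rfl, hb⟩ := ih₂ s hs
      cases h.value with
      | inj₂ hval =>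
        obtain ⟨u, h₃, hu⟩ := hb v hval hv
        exact ⟨u, .case₂ h (.app h₂ hval.eval h₃), hu⟩
  | abort _ ih =>
    obtain ⟨_, _, hv⟩ := ih s hs
    exact hv.elim
  | eta _ ih =>
    obtain ⟨v, h, hv⟩ := ih s hs
    exact ⟨_, .eta h, v, rfl, hv⟩
  | bind _ _ _ ih₁ ih₂ =>
    obtain ⟨_, h, v, rfl, hv⟩ := ih₁ s hs
    cases h.value with
    | eta hval =>
      obtain ⟨u, h₂, hu⟩ := ih₂ _ (extend hs hval hv)
      rw [← Tm.inst_subst_upSub] at h₂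
      exact ⟨u, .bind h h₂, hu⟩

theorem HasType.exists_eval {a : Tm L} {A : Ty L} (h : HasType [] a A) :
    ∃ v, Eval a v ∧ Norm A v := by
  simpa [Tm.subst_var] using h.exists_eval_subst Tm.var (by simp)

end Normalization

/-! ### Indistinguishability for an observer -/

section Indistinguishability

variable {L : Type u} [SemilatticeSup L]

/-- Indistinguishability of values for an observer at level `k`; it is insensitive to
termination. -/
def Rel (k : L) : Ty L → Tm L → Tm L → Prop
  | .unit, v₁, v₂ => v₁ = v₂
  | .void, _, _ => True
  | .fn A B, v₁, v₂ => ∀ T₁ b₁ T₂ b₂, v₁ = Tm.lam T₁ b₁ → v₂ = Tm.lam T₂ b₂ →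
      ∀ w₁ w₂, Value w₁ → Value w₂ → Rel k A w₁ w₂ →
      ∀ u₁ u₂, Eval (Tm.inst b₁ w₁) u₁ → Eval (Tm.inst b₂ w₂) u₂ → Rel k B u₁ u₂
  | .prod A B, v₁, v₂ => ∀ a₁ b₁ a₂ b₂, v₁ = Tm.pair a₁ b₁ → v₂ = Tm.pair a₂ b₂ →
      Rel k A a₁ a₂ ∧ Rel k B b₁ b₂
  | .sum A B, v₁, v₂ => (∃ a₁ a₂, v₁ = Tm.inj₁ a₁ ∧ v₂ = Tm.inj₁ a₂ ∧ Rel k A a₁ a₂) ∨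
      (∃ b₁ b₂, v₁ = Tm.inj₂ b₁ ∧ v₂ = Tm.inj₂ b₂ ∧ Rel k B b₁ b₂)
  | .mon l A, v₁, v₂ => l ≤ k → ∀ a₁ a₂, v₁ = Tm.eta l a₁ → v₂ = Tm.eta l a₂ → Rel k A a₁ a₂

/-- The sum clause of `Rel` demands equal tags at every level. `Protect.rel` tolerates this because
no structural protection rule concludes at a sum. -/
theorem Rel.eq_of_bool {k : L} {v₁ v₂ : Tm L} (h : Rel k Ty.bool v₁ v₂) : v₁ = v₂ := by
  obtain ⟨a, b, rfl, rfl, hab⟩ | ⟨a, b, rfl, rfl, hab⟩ := h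
  · exact congrArg Tm.inj₁ hab
  · exact congrArg Tm.inj₂ hab

variable [OrderBot L]

/-- The clauses of `Rel` for functions, products and `T` are implications, so they hold for
arbitrary terms once their conclusions do. -/
theorem Protect.rel {k l : L} {A : Ty L} (h : Protect l A) (hl : ¬ l ≤ k) (v₁ v₂ : Tm L) :
    Rel k A v₁ v₂ := by
  induction h generalizing v₁ v₂ with
  | prod _ _ ih₁ ih₂ => exact fun _ _ _ _ _ _ => ⟨ih₁ hl _ _, ih₂ hl _ _⟩
  | fn _ ih => exact fun _ _ _ _ _ _ _ _ _ _ _ _ _ _ _ => ih hl _ _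
  | monad h => exact fun h' => absurd (h.trans h') hl
  | already _ ih => exact fun _ _ _ _ _ => ih hl _ _
  | minimum => exact absurd bot_le hl
  -- As `l ≤ l₁ ⊔ l₂`, one of `l₁`, `l₂` must fail to be below `k`.
  | @combine l l₁ l₂ A _ _ h ih₁ ih₂ =>
    by_cases h₁ : l₁ ≤ k
    · by_cases h₂ : l₂ ≤ k
      · exact absurd (h.trans (sup_le h₁ h₂)) hl
      · exact ih₂ h₂ _ _
    · exact ih₁ h₁ _ _

/-- Fundamental lemma for `Rel`. Both evaluations are hypotheses, so termination plays no role here.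
-/
theorem HasType.rel_subst {k : L} {Γ : List (Ty L)} {a : Tm L} {A : Ty L} (h : HasType Γ a A)
    {s₁ s₂ : ℕ → Tm L}
    (hs : ∀ n B, Γ[n]? = some B → Value (s₁ n) ∧ Value (s₂ n) ∧ Rel k B (s₁ n) (s₂ n))
    {v₁ v₂ : Tm L} (h₁ : Eval (Tm.subst s₁ a) v₁) (h₂ : Eval (Tm.subst s₂ a) v₂) :
    Rel k A v₁ v₂ := by
  have extend : ∀ {Γ : List (Ty L)} {s₁ s₂ : ℕ → Tm L} {C : Ty L} {w₁ w₂ : Tm L},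
      (∀ n B, Γ[n]? = some B → Value (s₁ n) ∧ Value (s₂ n) ∧ Rel k B (s₁ n) (s₂ n)) →
      Value w₁ → Value w₂ → Rel k C w₁ w₂ →
      ∀ n B, (C :: Γ)[n]? = some B → Value (Tm.cons w₁ s₁ n) ∧ Value (Tm.cons w₂ s₂ n) ∧
        Rel k B (Tm.cons w₁ s₁ n) (Tm.cons w₂ s₂ n) := by
    intro Γ s₁ s₂ C w₁ w₂ hs hw₁ hw₂ hC n B hn
    cases n with
    | zero => cases hn; exact ⟨hw₁, hw₂, hC⟩
    | succ n => exact hs n B hn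
  induction h generalizing s₁ s₂ v₁ v₂ with
  | var h =>
    obtain ⟨hv₁, hv₂, hr⟩ := hs _ _ h
    rw [hv₁.eq_of_eval h₁, hv₂.eq_of_eval h₂]
    exact hr
  | lam _ ih =>
    cases h₁
    cases h₂
    rintro _ _ _ _ ⟨⟩ ⟨⟩ w₁ w₂ hw₁ hw₂ hw u₁ u₂ hu₁ hu₂
    rw [Tm.inst_subst_upSub] at hu₁ hu₂
    exact ih (extend hs hw₁ hw₂ hw) hu₁ hu₂
  | app _ _ ihf iha =>
    cases h₁ with
    | app f₁ a₁ r₁ =>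
      cases h₂ with
      | app f₂ a₂ r₂ =>
        exact ihf hs f₁ f₂ _ _ _ _ rfl rfl _ _ a₁.value a₂.value (iha hs a₁ a₂) _ _ r₁ r₂
  | pair _ _ ih₁ ih₂ =>
    cases h₁ with
    | pair a₁ b₁ =>
      cases h₂ with
      | pair a₂ b₂ =>
        rintro _ _ _ _ ⟨⟩ ⟨⟩
        exact ⟨ih₁ hs a₁ a₂, ih₂ hs b₁ b₂⟩
  | proj₁ _ ih =>
    cases h₁ with
    | proj₁ h₁ => cases h₂ with | proj₁ h₂ => exact (ih hs h₁ h₂ _ _ _ _ rfl rfl).1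
  | proj₂ _ ih =>
    cases h₁ with
    | proj₂ h₁ => cases h₂ with | proj₂ h₂ => exact (ih hs h₁ h₂ _ _ _ _ rfl rfl).2
  | unit =>
    cases h₁
    cases h₂
    rfl
  | inj₁ _ ih =>
    cases h₁ with
    | inj₁ h₁ => cases h₂ with | inj₁ h₂ => exact .inl ⟨_, _, rfl, rfl, ih hs h₁ h₂⟩
  | inj₂ _ ih =>
    cases h₁ with
    | inj₂ h₁ => cases h₂ with | inj₂ h₂ => exact .inr ⟨_, _, rfl, rfl, ih hs h₁ h₂⟩
  | @caseOf Γ A₁ A₂ B a b₁ b₂ _ _ _ ih ihb₁ ihb₂ =>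
    have branch : ∀ {C : Ty L} {b w₁ w₂ : Tm L},
        (∀ {v₁ v₂ : Tm L}, Eval (Tm.subst s₁ b) v₁ → Eval (Tm.subst s₂ b) v₂ →
          Rel k (.fn C B) v₁ v₂) →
        Value w₁ → Value w₂ → Rel k C w₁ w₂ → Eval (Tm.app (Tm.subst s₁ b) w₁) v₁ →
        Eval (Tm.app (Tm.subst s₂ b) w₂) v₂ → Rel k B v₁ v₂ := by
      intro C b w₁ w₂ hb hw₁ hw₂ hw e₁ e₂
      cases e₁ with
      | app f₁ a₁ r₁ =>
        cases e₂ with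
        | app f₂ a₂ r₂ =>
          rw [hw₁.eq_of_eval a₁] at r₁
          rw [hw₂.eq_of_eval a₂] at r₂
          exact hb f₁ f₂ _ _ _ _ rfl rfl _ _ hw₁ hw₂ hw _ _ r₁ r₂
    cases h₁ with
    | case₁ c₁ e₁ =>
      cases h₂ with
      | case₁ c₂ e₂ =>
        obtain ⟨_, _, ⟨⟩, ⟨⟩, hw⟩ | ⟨_, _, ⟨⟩, _⟩ := ih hs c₁ c₂
        cases c₁.value with
        | inj₁ hw₁ => cases c₂.value with | inj₁ hw₂ => exact branch (ihb₁ hs) hw₁ hw₂ hw e₁ e₂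
      -- Related scrutinees carry the same tag, so the two runs cannot take different branches.
      | case₂ c₂ e₂ => obtain ⟨_, _, _, ⟨⟩, _⟩ | ⟨_, _, ⟨⟩, _⟩ := ih hs c₁ c₂
    | case₂ c₁ e₁ =>
      cases h₂ with
      | case₁ c₂ e₂ => obtain ⟨_, _, ⟨⟩, _⟩ | ⟨_, _, _, ⟨⟩, _⟩ := ih hs c₁ c₂
      | case₂ c₂ e₂ =>
        obtain ⟨_, _, ⟨⟩, _⟩ | ⟨_, _, ⟨⟩, ⟨⟩, hw⟩ := ih hs c₁ c₂
        cases c₁.value with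
        | inj₂ hw₁ => cases c₂.value with | inj₂ hw₂ => exact branch (ihb₂ hs) hw₁ hw₂ hw e₁ e₂
  | abort _ _ => cases h₁
  | eta _ ih =>
    cases h₁ with
    | eta h₁ =>
      cases h₂ with
      | eta h₂ =>
        rintro _ _ _ ⟨⟩ ⟨⟩
        exact ih hs h₁ h₂
  | @bind Γ l A B a b _ _ hp iha ihb =>
    -- If `l` is visible to `k`, the unwrapped contents are related and the body preserves this.
    -- Otherwise the contents may differ, but the side condition `l ⊑ B` makes all results related.
    by_cases hl : l ≤ k
    · cases h₁ with
      | bind a₁ e₁ =>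
        cases h₂ with
        | bind a₂ e₂ =>
          rw [Tm.inst_subst_upSub] at e₁ e₂
          cases a₁.value with
          | eta hw₁ =>
            cases a₂.value with
            | eta hw₂ =>
              exact ihb (extend hs hw₁ hw₂ (iha hs a₁ a₂ hl _ _ rfl rfl)) e₁ e₂
    · exact hp.rel hl _ _

theorem HasType.rel {k : L} {a v₁ v₂ : Tm L} {A : Ty L} (h : HasType [] a A)
    (h₁ : Eval a v₁) (h₂ : Eval a v₂) : Rel k A v₁ v₂ :=
  h.rel_subst (s₁ := Tm.var) (s₂ := Tm.var) (by simp) (by rwa [Tm.subst_var])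
    (by rwa [Tm.subst_var])

/-- Applications of a function to arguments of a protected type have indistinguishable results. -/
theorem rel_of_eval_app {k l : L} {A B : Ty L} {f a₁ a₂ v₁ v₂ : Tm L} (hl : ¬ l ≤ k)
    (hp : Protect l A) (hf : HasType [] f (Ty.fn A B))
    (h₁ : Eval (Tm.app f a₁) v₁) (h₂ : Eval (Tm.app f a₂) v₂) : Rel k B v₁ v₂ := by
  cases h₁ with
  | app f₁ w₁ r₁ =>
    cases h₂ with
    | app f₂ w₂ r₂ =>
      exact hf.rel (k := k) f₁ f₂ _ _ _ _ rfl rfl _ _ w₁.value w₂.value (hp.rel hl _ _) _ _ r₁ r₂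

/-- Normalization gives the second run a value, and the observer at `⊥` identifies it with `v`. -/
theorem steps_app_of_protect_bool {l : L} {A : Ty L} {f a₁ a₂ v : Tm L} (hl : ¬ l ≤ ⊥)
    (hp : Protect l A) (hf : HasType [] f (Ty.fn A Ty.bool)) (ha₂ : HasType [] a₂ A)
    (hv : Value v) (h : Steps (Tm.app f a₁) v) : Steps (Tm.app f a₂) v := by
  obtain ⟨w, hw, -⟩ := (HasType.app hf ha₂).exists_eval
  rw [(rel_of_eval_app hl hp hf ((steps_iff_eval hv).1 h) hw).eq_of_bool]
  exact hw.steps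

theorem steps_app_of_protect_mon {l l' : L} {A : Ty L} {f a₁ a₂ v : Tm L} (hl : ¬ l ≤ l')
    (hp : Protect l A) (hf : HasType [] f (Ty.fn A (Ty.mon l' Ty.bool))) (ha₂ : HasType [] a₂ A)
    (hv : Value v) (hvt : HasType [] v (Ty.mon l' Ty.bool)) (h : Steps (Tm.app f a₁) v) :
    Steps (Tm.app f a₂) v := by
  obtain ⟨_, hw, w, rfl, -⟩ := (HasType.app hf ha₂).exists_eval
  have hr := rel_of_eval_app hl hp hf ((steps_iff_eval hv).1 h) hw
  -- At type `T_l'` the relation says nothing about terms not of the form `eta l' _`; typing forces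
  -- `v` into that form.
  cases hv with
  | eta =>
    cases hvt with
    | eta =>
      rw [(hr le_rfl _ _ rfl rfl).eq_of_bool]
      exact hw.steps
  | _ => cases hvt

end Indistinguishability

end DCCe

theorem mainTheorem7 {L : Type u} [SemilatticeSup L] [OrderBot L] :
    (∀ (l : L) (A : DCCe.Ty L) (f a₁ a₂ : DCCe.Tm L),
      ¬ l ≤ ⊥ → DCCe.Protect l A →
      DCCe.HasType [] f (DCCe.Ty.fn A DCCe.Ty.bool) →
      DCCe.HasType [] a₁ A → DCCe.HasType [] a₂ A →
      ∀ v : DCCe.Tm L, DCCe.Value v → DCCe.HasType [] v DCCe.Ty.bool →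
        (DCCe.Steps (DCCe.Tm.app f a₁) v ↔ DCCe.Steps (DCCe.Tm.app f a₂) v)) ∧
    (∀ (l l' : L) (A : DCCe.Ty L) (f a₁ a₂ : DCCe.Tm L),
      ¬ l ≤ l' → DCCe.Protect l A →
      DCCe.HasType [] f (DCCe.Ty.fn A (DCCe.Ty.mon l' DCCe.Ty.bool)) →
      DCCe.HasType [] a₁ A → DCCe.HasType [] a₂ A →
      ∀ v : DCCe.Tm L, DCCe.Value v → DCCe.HasType [] v (DCCe.Ty.mon l' DCCe.Ty.bool) →
        (DCCe.Steps (DCCe.Tm.app f a₁) v ↔ DCCe.Steps (DCCe.Tm.app f a₂) v)) := by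
  refine ⟨fun l A f a₁ a₂ hl hp hf ha₁ ha₂ v hv _ => ⟨?_, ?_⟩,
    fun l l' A f a₁ a₂ hl hp hf ha₁ ha₂ v hv hvt => ⟨?_, ?_⟩⟩
  · exact DCCe.steps_app_of_protect_bool hl hp hf ha₂ hv
  · exact DCCe.steps_app_of_protect_bool hl hp hf ha₁ hv
  · exact DCCe.steps_app_of_protect_mon hl hp hf ha₂ hv hvt
  · exact DCCe.steps_app_of_protect_mon hl hp hf ha₁ hv hvt
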